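/- Let $a<b$, $T>0$, $\nu>0$ and $\mu>0$ be real numbers, and let $u_0\in H^1_0(a,b)$, $u_1\in L^2(a,b)$, $\theta_0\in H^1(a,b)$ with $\theta_0\ge 0$. Consider the regularized (viscous) problem $$ \begin{aligned} &u_{tt}-u_{xx}-\nu u_{txx}=-\mu\theta_x, \qquad \theta_t-\theta_{xx}+\mu\,\theta\,u_{tx}=0,\qquad \theta\ge 0 \qquad\text{in }(0,T)\times(a,b),\\ &u(t,a)=u(t,b)=0,\qquad \theta_x(t,a)=\theta_x(t,b)=0,\\ &u(0,\cdot)=u_0,\qquad u_t(0,\cdot)=u_1,\qquad \theta(0,\cdot)=\theta_0 . \end{aligned} $$ A pair $(u,\theta)$ is a weak solution of this problem if 1. $u\in W^{1,\infty}(0,T;L^2(a,b))\cap H^1(0,T;H^1_0(a,b))$ and $u_{tt}\in L^2(0,T;H^{-1}(a,b))$; 2. $\theta\in H^1(0,T;L^2(a,b))\cap L^2(0,T;H^2(a,b))$ and $\theta\ge 0$; 3. for all $v\in H^1_0(a,b)$ and $\psi\in H^1(a,b)$ and for almost every $t\in(0,T)$, $$ \langle u_{tt},v\rangle_{H^{-1},H^1_0}+\int_a^b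 u_xv_x\,dx+\nu\int_a^b u_{tx}v_x\,dx+\mu\int_a^b\theta_x v\,dx=0, $$ $$ \int_a^b\theta_t\psi\,dx+\int_a^b\theta_x\psi_x\,dx+\mu\int_a^b\theta\,u_{tx}\psi\,dx=0; $$ 4. $u(0)=u_0$ in $H^1_0(a,b)$, $u_t(0)=u_1$ in $L^2(a,b)$ and $\theta(0)=\theta_0$ in $L^2(a,b)$, in the sense of limits as $t\downarrow 0$ (equivalently, for the representatives $u\in C([0,T];H^1_0(a,b))$, $u_t\in C([0,T];L^2(a,b))$, $\theta\in C([0,T];L^2(a,b))$). Then the weak solution is unique: if $(u,\theta)$ and $(\tilde u,\tilde\theta)$ are two weak solutions on $(0,T)$ with the same data $(u_0,u_1,\theta_0)$, then $u(t)=\tilde u(t)$ and $\theta(t)=\tilde\theta(t)$ for almost every $t\in(0,T)$. -/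

import Mathlib

open MeasureTheory Filter Topology Set
open scoped ContDiff ENNReal

namespace Thermo

/-- Smooth real functions of one variable with compact support contained in the open
interval `(a, b)`. -/
def IsTest (a b : ℝ) (φ : ℝ → ℝ) : Prop :=
  ContDiff ℝ ∞ φ ∧ HasCompactSupport φ ∧ tsupport φ ⊆ Ioo a b

/-! ### Function spaces in the space variable -/

/-- The Lebesgue space `L²(a, b)`. -/
abbrev L2 (a b : ℝ) : Type := Lp ℝ 2 (volume.restrict (Ioo a b))

/-- `g ∈ L²(a, b)` is the weak derivative of `f ∈ L²(a, b)` on `(a, b)`. -/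
def IsWeakDeriv {a b : ℝ} (f g : L2 a b) : Prop :=
  ∀ φ : ℝ → ℝ, IsTest a b φ →
    ∫ x in Ioo a b, f x * deriv φ x = -∫ x in Ioo a b, g x * φ x

theorem IsTest.memLp {a b : ℝ} {φ : ℝ → ℝ} (h : IsTest a b φ) :
    MemLp φ 2 (volume.restrict (Ioo a b)) :=
  (h.1.continuous.memLp_of_hasCompactSupport h.2.1).restrict _

theorem IsTest.memLp_deriv {a b : ℝ} {φ : ℝ → ℝ} (h : IsTest a b φ) :
    MemLp (deriv φ) 2 (volume.restrict (Ioo a b)) :=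
  ((h.1.continuous_deriv (by simp)).memLp_of_hasCompactSupport h.2.1.deriv).restrict _

theorem integral_mul_eq_inner {a b : ℝ} (f : L2 a b) {φ : ℝ → ℝ}
    (h : MemLp φ 2 (volume.restrict (Ioo a b))) :
    ∫ x in Ioo a b, f x * φ x = inner ℝ (h.toLp φ) f := by
  rw [L2.inner_def]
  refine integral_congr_ae ?_
  filter_upwards [h.coeFn_toLp] with x hx
  simp [hx]

theorem isWeakDeriv_iff {a b : ℝ} (f g : L2 a b) :
    IsWeakDeriv f g ↔ ∀ φ : ℝ → ℝ, ∀ h : IsTest a b φ,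
      inner ℝ (h.memLp_deriv.toLp _) f + inner ℝ (h.memLp.toLp _) g = (0 : ℝ) := by
  refine forall_congr' fun φ => forall_congr' fun h => ?_
  rw [integral_mul_eq_inner f h.memLp_deriv, integral_mul_eq_inner g h.memLp,
    eq_neg_iff_add_eq_zero]

/-- The Sobolev space `H^k(a, b)`, as the space of all tuples `(f, f', …, f^(k))` in `L²(a, b)`
in which each entry is the weak derivative of the preceding one. It carries the norm
`‖f‖² = ∑_{i ≤ k} ‖f^(i)‖²_{L²}`. -/
def Hk (a b : ℝ) (k : ℕ) : Submodule ℝ (PiLp 2 fun _ : Fin (k + 1) => L2 a b) where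
  carrier := {f | ∀ i : Fin k, IsWeakDeriv (f i.castSucc) (f i.succ)}
  zero_mem' := by
    intro i
    rw [isWeakDeriv_iff]
    intro φ h
    simp
  add_mem' := by
    intro f g hf hg i
    have h1 := (isWeakDeriv_iff _ _).1 (hf i)
    have h2 := (isWeakDeriv_iff _ _).1 (hg i)
    rw [isWeakDeriv_iff]
    intro φ h
    simp only [PiLp.add_apply, inner_add_right]
    linarith [h1 φ h, h2 φ h]
  smul_mem' := by
    intro c f hf i
    have h1 := (isWeakDeriv_iff _ _).1 (hf i)
    rw [isWeakDeriv_iff]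
    intro φ h
    simp only [PiLp.smul_apply, real_inner_smul_right]
    rw [← mul_add, h1 φ h, mul_zero]

theorem isClosed_Hk (a b : ℝ) (k : ℕ) :
    IsClosed (Hk a b k : Set (PiLp 2 fun _ : Fin (k + 1) => L2 a b)) := by
  have : (Hk a b k : Set (PiLp 2 fun _ : Fin (k + 1) => L2 a b)) =
      ⋂ (i : Fin k) (φ : ℝ → ℝ) (h : IsTest a b φ),
        {f | inner ℝ (h.memLp_deriv.toLp _) (f i.castSucc)
          + inner ℝ (h.memLp.toLp _) (f i.succ) = (0 : ℝ)} := by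
    ext f
    simp only [mem_iInter, mem_ofPred_eq]
    exact forall_congr' fun i => isWeakDeriv_iff _ _
  rw [this]
  refine isClosed_iInter fun i => isClosed_iInter fun φ => isClosed_iInter fun h => ?_
  exact isClosed_eq (by fun_prop) continuous_const

instance instCompleteSpaceHk (a b : ℝ) (k : ℕ) : CompleteSpace (Hk a b k) :=
  (isClosed_Hk a b k).completeSpace_coe

/-- The `i`-th weak derivative of an element of `H^k(a, b)`, `i = 0, …, k`. -/
noncomputable def D {a b : ℝ} {k : ℕ} (i : Fin (k + 1)) : Hk a b k →L[ℝ] L2 a b :=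
  (PiLp.proj 2 (fun _ : Fin (k + 1) => L2 a b) i : _ →L[ℝ] L2 a b).comp (Hk a b k).subtypeL

/-- `H^1_0(a, b)`, the closure in `H^1(a, b)` of the smooth functions with compact support
in `(a, b)`. -/
noncomputable def H10 (a b : ℝ) : Submodule ℝ (Hk a b 1) :=
  (Submodule.span ℝ {f : Hk a b 1 | ∃ φ : ℝ → ℝ, IsTest a b φ ∧
    D 0 f =ᵐ[volume.restrict (Ioo a b)] φ}).topologicalClosure

instance instCompleteSpaceH10 (a b : ℝ) : CompleteSpace (H10 a b) :=
  (Submodule.isClosed_topologicalClosure _).completeSpace_coe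

/-- The `i`-th weak derivative of an element of `H^1_0(a, b)`, `i = 0, 1`. -/
noncomputable def D0 {a b : ℝ} (i : Fin 2) : H10 a b →L[ℝ] L2 a b :=
  (D i).comp (H10 a b).subtypeL

/-- `H^{-1}(a, b)`, the dual space of `H^1_0(a, b)`. -/
abbrev Hneg (a b : ℝ) : Type := StrongDual ℝ (H10 a b)

/-- The embedding `L²(a, b) → H^{-1}(a, b)`, `f ↦ (v ↦ ∫ f v)`. -/
noncomputable def toHneg {a b : ℝ} (f : L2 a b) : Hneg a b :=
  (innerSL ℝ f).comp (D0 0)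

/-! ### Functions of time with values in a Banach space -/

/-- Lebesgue measure on the time interval `(0, T)`. -/
noncomputable abbrev timeMeasure (T : ℝ) : Measure ℝ := volume.restrict (Ioo 0 T)

/-- `g` is the weak derivative on `(0, T)` of the vector-valued function `f`
(both are Bochner integrable on `(0, T)` wherever this is used). -/
def IsWeakTimeDeriv {X : Type*} [NormedAddCommGroup X] [NormedSpace ℝ X]
    (T : ℝ) (f g : ℝ → X) : Prop :=
  ∀ φ : ℝ → ℝ, IsTest 0 T φ →
    ∫ t in Ioo 0 T, deriv φ t • f t = -∫ t in Ioo 0 T, φ t • g t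

/-- `f` has the initial value `x₀`: `f t → x₀` as `t ↓ 0`, up to a null set of times.
For a function that agrees a.e. near `0` with one continuous on `[0, T]`, this says that
the continuous representative takes the value `x₀` at `0`. -/
def HasInitialValue {X : Type*} [NormedAddCommGroup X] (f : ℝ → X) (x₀ : X) : Prop :=
  Tendsto f (𝓝[>] (0 : ℝ) ⊓ ae volume) (𝓝 x₀)

/-! ### Weak solutions of the viscous problem -/

/-- `(u, θ)` is a weak solution on `(0, T) × (a, b)` of
`u_tt - u_xx - ν u_txx = -μ θ_x`, `θ_t - θ_xx + μ θ u_tx = 0`, `θ ≥ 0`, with `u = 0` and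
`θ_x = 0` at `x = a, b`, and with the initial data `(u₀, u₁, θ₀)` for `(u, u_t, θ)`.
Here `ut`, `utt`, `θt` are the weak time derivatives. -/
structure IsWeakSolutionWith (a b μ ν T : ℝ) (u₀ : H10 a b) (u₁ : L2 a b) (θ₀ : Hk a b 1)
    (u ut : ℝ → H10 a b) (utt : ℝ → Hneg a b) (θ : ℝ → Hk a b 2) (θt : ℝ → L2 a b) :
    Prop where
  /-- `u ∈ H¹(0, T; H¹_0(a, b))` -/
  u_mem : MemLp u 2 (timeMeasure T)
  ut_mem : MemLp ut 2 (timeMeasure T)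
  deriv_u : IsWeakTimeDeriv T u ut
  /-- `u ∈ W^{1,∞}(0, T; L²(a, b))` -/
  u_mem_top : MemLp (fun t => D0 0 (u t)) ∞ (timeMeasure T)
  ut_mem_top : MemLp (fun t => D0 0 (ut t)) ∞ (timeMeasure T)
  /-- `u_tt ∈ L²(0, T; H^{-1}(a, b))` -/
  utt_mem : MemLp utt 2 (timeMeasure T)
  deriv_ut : IsWeakTimeDeriv T (fun t => toHneg (D0 0 (ut t))) utt
  /-- `θ ∈ L²(0, T; H²(a, b))` -/
  θ_mem : MemLp θ 2 (timeMeasure T)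
  /-- `θ ∈ H¹(0, T; L²(a, b))` -/
  θt_mem : MemLp θt 2 (timeMeasure T)
  deriv_θ : IsWeakTimeDeriv T (fun t => D 0 (θ t)) θt
  /-- `θ ≥ 0` -/
  θ_nonneg : ∀ᵐ t ∂timeMeasure T, 0 ≤ D 0 (θ t)
  /-- the wave equation, tested with `v ∈ H¹_0(a, b)` -/
  wave : ∀ v : H10 a b, ∀ᵐ t ∂timeMeasure T,
    utt t v + (∫ x in Ioo a b, D0 1 (u t) x * D0 1 v x)
      + ν * (∫ x in Ioo a b, D0 1 (ut t) x * D0 1 v x)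
      + μ * (∫ x in Ioo a b, D 1 (θ t) x * D0 0 v x) = 0
  /-- the heat equation, tested with `ψ ∈ H¹(a, b)` -/
  heat : ∀ ψ : Hk a b 1, ∀ᵐ t ∂timeMeasure T,
    (∫ x in Ioo a b, θt t x * D 0 ψ x)
      + (∫ x in Ioo a b, D 1 (θ t) x * D 1 ψ x)
      + μ * (∫ x in Ioo a b, D 0 (θ t) x * D0 1 (ut t) x * D 0 ψ x) = 0
  init_u : HasInitialValue u u₀
  init_ut : HasInitialValue (fun t => D0 0 (ut t)) u₁
  init_θ : HasInitialValue (fun t => D 0 (θ t)) (D 0 θ₀)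

/-- `(u, θ)` is a weak solution of the viscous problem on `(0, T)` with initial data
`(u₀, u₁, θ₀)`. -/
def IsWeakSolution (a b μ ν T : ℝ) (u₀ : H10 a b) (u₁ : L2 a b) (θ₀ : Hk a b 1)
    (u : ℝ → H10 a b) (θ : ℝ → Hk a b 2) : Prop :=
  ∃ (ut : ℝ → H10 a b) (utt : ℝ → Hneg a b) (θt : ℝ → L2 a b),
    IsWeakSolutionWith a b μ ν T u₀ u₁ θ₀ u ut utt θ θt

end Thermo

/-! Energy method for the difference of two solutions. Put `w = u - v`, `z = θ - η`, `E = ‖w_t‖² +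
‖w‖²_{H¹} + ‖z‖²`, and test the difference of the wave equations with `w_t` and that of the heat
equations with `z`. The nonlinearity splits as `θ u_tx - η v_tx = z u_tx + η w_tx`. By the embedding
`H¹ ⊆ L^∞` (`exists_ae_abs_le`) the factors `z` and `η` are bounded in space by their `H¹` norms.
Young's inequality then absorbs `‖z_x‖` into the heat diffusion and `‖w_tx‖` into the viscous term,
which is where `ν > 0` enters (`energy_inequality`). What remains is `E' ≤ k E`, where `k` involves
`‖u_tx‖²` and `‖η‖²_{H¹}` and is therefore integrable in time; since `E` starts at zero, Grönwall's
lemma gives `E = 0`.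

Two points need care. First, `E` is differentiable only in a weak sense, because `u_tt` lies in
`H^{-1}`. The formula `E = ∫ E'` comes from the Lions–Magenes identity (`norm_sq_sub_norm_sq`),
proved by mollification in time; its scalar case, applied in the space variable, also yields the
Sobolev embedding. Second, the equations hold off a null set of times depending on the test
function, whereas `w_t` and `z` vary with time; separability of the test spaces removes this
dependence (`ae_forall_eq_zero_of_forall_ae`). -/

namespace Thermo

open scoped Convolution

/-! ### Dominated convergence with varying majorants -/

/-- Dominated convergence with a convergent sequence of dominating functions. -/
theorem tendsto_integral_of_dominated_by_convergent {α : Type*} [MeasurableSpace α]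
    {m : Measure α} {q h : ℕ → α → ℝ} {q₀ h₀ : α → ℝ}
    (hqm : ∀ n, AEStronglyMeasurable (q n) m)
    (hh : ∀ n, Integrable (h n) m) (hh₀ : Integrable h₀ m)
    (hle : ∀ n, ∀ᵐ x ∂m, |q n x| ≤ h n x)
    (hq : ∀ᵐ x ∂m, Tendsto (fun n => q n x) atTop (𝓝 (q₀ x)))
    (hhlim : ∀ᵐ x ∂m, Tendsto (fun n => h n x) atTop (𝓝 (h₀ x)))
    (hint : Tendsto (fun n => ∫ x, h n x ∂m) atTop (𝓝 (∫ x, h₀ x ∂m))) :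
    Tendsto (fun n => ∫ x, q n x ∂m) atTop (𝓝 (∫ x, q₀ x ∂m)) := by
  have hle' : ∀ᵐ x ∂m, ∀ n, |q n x| ≤ h n x := ae_all_iff.2 hle
  have hq₀ : ∀ᵐ x ∂m, |q₀ x| ≤ h₀ x := by
    filter_upwards [hle', hq, hhlim] with x h1 h2 h3
    exact le_of_tendsto_of_tendsto' h2.abs h3 h1
  have hqi : ∀ n, Integrable (q n) m := fun n => (hh n).mono' (hqm n) (hle n)
  -- Truncating `q n` to `[-h₀, h₀]` puts it under the usual dominated convergence theorem. The
  -- truncation error is at most `(h n - h₀)⁺ = (h n - h₀) + (h₀ - h n)⁺`; the first summand has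
  -- integral tending to zero by `hint`, the second is dominated by `h₀`.
  let c : ℕ → α → ℝ := fun n x => max (-h₀ x) (min (h₀ x) (q n x))
  have hcm : ∀ n, AEStronglyMeasurable (c n) m := fun n =>
    hh₀.aestronglyMeasurable.neg.sup (hh₀.aestronglyMeasurable.inf (hqm n))
  have hcle : ∀ n, ∀ᵐ x ∂m, ‖c n x‖ ≤ h₀ x := by
    intro n
    filter_upwards [hq₀] with x hx
    have := (abs_nonneg _).trans hx
    rw [Real.norm_eq_abs, abs_le]
    exact ⟨le_max_left _ _, max_le (by linarith) (min_le_left _ _)⟩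
  have hci : ∀ n, Integrable (c n) m := fun n => hh₀.mono' (hcm n) (hcle n)
  have hclim : Tendsto (fun n => ∫ x, c n x ∂m) atTop (𝓝 (∫ x, q₀ x ∂m)) := by
    refine tendsto_integral_of_dominated_convergence h₀ hcm hh₀ hcle ?_
    filter_upwards [hq₀, hq] with x h1 h2
    have h3 : q₀ x = max (-h₀ x) (min (h₀ x) (q₀ x)) := by
      rw [min_eq_right (abs_le.1 h1).2, max_eq_right (abs_le.1 h1).1]
    rw [h3]
    exact tendsto_const_nhds.max (tendsto_const_nhds.min h2)
  let d : ℕ → α → ℝ := fun n x => max (h₀ x - h n x) 0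
  have hdm : ∀ n, AEStronglyMeasurable (d n) m := fun n =>
    (hh₀.aestronglyMeasurable.sub (hh n).aestronglyMeasurable).sup aestronglyMeasurable_const
  have hdle : ∀ n, ∀ᵐ x ∂m, ‖d n x‖ ≤ h₀ x := by
    intro n
    filter_upwards [hq₀, hle n] with x h1 h2
    have := (abs_nonneg _).trans h1
    have := (abs_nonneg _).trans h2
    rw [Real.norm_eq_abs, abs_of_nonneg (le_max_right _ _)]
    exact max_le (by linarith) (by linarith)
  have hdi : ∀ n, Integrable (d n) m := fun n => hh₀.mono' (hdm n) (hdle n)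
  have hdlim : Tendsto (fun n => ∫ x, d n x ∂m) atTop (𝓝 0) := by
    have : (0 : ℝ) = ∫ _, (0 : ℝ) ∂m := by simp
    rw [this]
    refine tendsto_integral_of_dominated_convergence h₀ hdm hh₀ hdle ?_
    filter_upwards [hhlim] with x h1
    have h2 := (tendsto_const_nhds (x := h₀ x)).sub h1
    rw [sub_self] at h2
    simpa using h2.max (tendsto_const_nhds (x := (0 : ℝ)))
  have hdiff : Tendsto (fun n => ∫ x, q n x ∂m - ∫ x, c n x ∂m) atTop (𝓝 0) := by
    have hb : Tendsto (fun n => (∫ x, h n x ∂m - ∫ x, h₀ x ∂m) + ∫ x, d n x ∂m)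
        atTop (𝓝 0) := by
      simpa using (hint.sub_const (∫ x, h₀ x ∂m)).add hdlim
    refine squeeze_zero_norm (fun n => ?_) hb
    have hs : (∫ x, h n x ∂m - ∫ x, h₀ x ∂m) + ∫ x, d n x ∂m
        = ∫ x, ((h n x - h₀ x) + d n x) ∂m := by
      rw [integral_add (f := fun x => h n x - h₀ x) ((hh n).sub hh₀) (hdi n),
        integral_sub (hh n) hh₀]
    rw [← integral_sub (hqi n) (hci n), hs]
    refine norm_integral_le_of_norm_le (((hh n).sub hh₀).add (hdi n)) ?_
    filter_upwards [hq₀, hle n] with x h1 h2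
    have := (abs_nonneg _).trans h1
    rw [abs_le] at h2
    have key : ∀ x y z : ℝ, 0 ≤ x → -y ≤ z → z ≤ y →
        |z - max (-x) (min x z)| ≤ (y - x) + max (x - y) 0 := by
      intro x y z _ _ _
      rw [abs_le]
      rcases min_cases x z with h | h <;> rcases max_cases (-x) (min x z) with h' | h' <;>
        rcases max_cases (x - y) 0 with h'' | h'' <;> constructor <;> linarith
    exact key _ _ _ this h2.1 h2.2
  simpa using hdiff.add hclim

/-! ### Mollification of vector-valued functions -/

/-- A sequence of bump functions with shrinking supports. -/
noncomputable def bump (n : ℕ) : ContDiffBump (0 : ℝ) where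
  -- Keeping `rOut = 2 * rIn` for every `n` gives the bounded ratio required for almost everywhere
  -- convergence of the mollifications.
  rIn := 1 / (2 * (n + 1))
  rOut := 1 / (n + 1)
  rIn_pos := by positivity
  rIn_lt_rOut := by
    apply one_div_lt_one_div_of_lt <;> linarith [n.cast_nonneg (α := ℝ)]

theorem tendsto_bump_rOut : Tendsto (fun n => (bump n).rOut) atTop (𝓝 0) :=
  tendsto_one_div_add_atTop_nhds_zero_nat

section Mollify

variable {E : Type*} [NormedAddCommGroup E] [NormedSpace ℝ E]

/-- The normalised bump function. -/
noncomputable abbrev kern (n : ℕ) : ℝ → ℝ := (bump n).normed volume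

/-- Regularisation of a function of one real variable by convolution with a bump function. -/
noncomputable def mollify (n : ℕ) (f : ℝ → E) : ℝ → E :=
  kern n ⋆[ContinuousLinearMap.lsmul ℝ ℝ, volume] f

theorem kern_contDiff (n : ℕ) : ContDiff ℝ ∞ (kern n) := (bump n).contDiff_normed

theorem kern_compact (n : ℕ) : HasCompactSupport (kern n) := (bump n).hasCompactSupport_normed

theorem mollify_apply (n : ℕ) (f : ℝ → E) (t : ℝ) :
    mollify n f t = ∫ s, kern n (t - s) • f s := by
  rw [mollify, convolution_eq_swap]; rfl

theorem tendsto_mollify [CompleteSpace E] {f : ℝ → E} (hf : LocallyIntegrable f) :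
    ∀ᵐ t, Tendsto (fun n => mollify n f t) atTop (𝓝 (f t)) :=
  ContDiffBump.ae_convolution_tendsto_right_of_locallyIntegrable (K := 2) tendsto_bump_rOut
    (Eventually.of_forall fun n => by
      have : (n : ℝ) + 1 ≠ 0 := by positivity
      simp only [bump]
      field_simp
      exact le_refl _) hf

theorem continuous_mollify (n : ℕ) {f : ℝ → E} (hf : LocallyIntegrable f) :
    Continuous (mollify n f) :=
  (kern_compact n).continuous_convolution_left _ (kern_contDiff n).continuous hf

theorem hasDerivAt_mollify [CompleteSpace E] (n : ℕ) {f : ℝ → E} (hf : LocallyIntegrable f) (t : ℝ) :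
    HasDerivAt (mollify n f) (∫ s, deriv (kern n) (t - s) • f s) t := by
  have := (kern_compact n).hasDerivAt_convolution_left (ContinuousLinearMap.lsmul ℝ ℝ)
    ((kern_contDiff n).of_le (by simp)) hf t
  rw [convolution_eq_swap] at this
  exact this

theorem integrable_kern_smul (n : ℕ) {f : ℝ → E} (hf : LocallyIntegrable f) (t : ℝ) :
    Integrable (fun s => kern n (t - s) • f s) := by
  refine hf.integrable_smul_left_of_hasCompactSupport
    ((kern_contDiff n).continuous.comp (by fun_prop)) ?_
  exact (kern_compact n).comp_homeomorph (Homeomorph.subLeft t)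

theorem integrable_deriv_kern_smul (n : ℕ) {f : ℝ → E} (hf : LocallyIntegrable f) (t : ℝ) :
    Integrable (fun s => deriv (kern n) (t - s) • f s) := by
  refine hf.integrable_smul_left_of_hasCompactSupport
    (((kern_contDiff n).continuous_deriv (by simp)).comp (by fun_prop)) ?_
  exact (kern_compact n).deriv.comp_homeomorph (Homeomorph.subLeft t)

theorem integral_kern_sub (n : ℕ) (t : ℝ) : ∫ s, kern n (t - s) = 1 := by
  rw [integral_sub_left_eq_self (kern n) volume t]
  exact (bump n).integral_normed

/-- Jensen's inequality for the probability density `kern n (t - ·)`, obtained by integrating `(‖f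
s‖ - m)² ≥ 0` with `m` the weighted mean of `‖f‖`. -/
theorem norm_mollify_sq_le (n : ℕ) {f : ℝ → E} (hf : Integrable f)
    (hf2 : Integrable fun t => ‖f t‖ ^ 2) (t : ℝ) :
    ‖mollify n f t‖ ^ 2 ≤ mollify n (fun t => ‖f t‖ ^ 2) t := by
  set m := ∫ s, kern n (t - s) * ‖f s‖ with hm
  have hnn : ∀ s, 0 ≤ kern n (t - s) := fun s => (bump n).nonneg_normed _
  have h1 : ‖mollify n f t‖ ≤ m := by
    rw [mollify_apply]
    refine (norm_integral_le_integral_norm _).trans_eq (integral_congr_ae (ae_of_all _ fun s => ?_))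
    simp only [norm_smul, Real.norm_eq_abs, abs_of_nonneg (hnn s)]
  have i1 : Integrable fun s => kern n (t - s) * ‖f s‖ := integrable_kern_smul n hf.norm.locallyIntegrable t
  have i2 : Integrable fun s => kern n (t - s) * ‖f s‖ ^ 2 :=
    integrable_kern_smul n hf2.locallyIntegrable t
  have i0 : Integrable fun s => kern n (t - s) := by
    simpa using integrable_kern_smul n (locallyIntegrable_const (1 : ℝ)) t
  have h2 : 0 ≤ ∫ s, (kern n (t - s) * ‖f s‖ ^ 2 - 2 * m * (kern n (t - s) * ‖f s‖)
      + m ^ 2 * kern n (t - s)) :=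
    integral_nonneg fun s => by
      have := mul_nonneg (hnn s) (sq_nonneg (‖f s‖ - m))
      simp only [Pi.zero_apply]
      linarith
  rw [integral_add (f := fun s => kern n (t - s) * ‖f s‖ ^ 2 - 2 * m * (kern n (t - s) * ‖f s‖))
      (i2.sub (i1.const_mul _)) (i0.const_mul _), integral_sub i2 (i1.const_mul _),
    integral_const_mul, integral_const_mul, integral_kern_sub, ← hm] at h2
  have h3 : mollify n (fun t => ‖f t‖ ^ 2) t = ∫ s, kern n (t - s) * ‖f s‖ ^ 2 :=
    mollify_apply _ _ _
  rw [h3]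
  have := pow_le_pow_left₀ (norm_nonneg _) h1 2
  linarith

theorem integrable_mollify (n : ℕ) {f : ℝ → E} (hf : Integrable f) :
    Integrable (mollify n f) :=
  Integrable.integrable_convolution _
    ((kern_contDiff n).continuous.integrable_of_hasCompactSupport (kern_compact n)) hf

theorem integral_mollify [CompleteSpace E] (n : ℕ) {f : ℝ → E} (hf : Integrable f) :
    ∫ t, mollify n f t = ∫ t, f t := by
  rw [mollify, integral_convolution _
    ((kern_contDiff n).continuous.integrable_of_hasCompactSupport (kern_compact n)) hf,
    (bump n).integral_normed]
  simp

/-- The reflected translate of the mollification kernel is a test function. -/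
theorem isTest_kern {a b t : ℝ} {n : ℕ} (h1 : a + (bump n).rOut < t)
    (h2 : t + (bump n).rOut < b) : IsTest a b fun s => kern n (t - s) := by
  refine ⟨(kern_contDiff n).comp (by fun_prop),
    (kern_compact n).comp_homeomorph (Homeomorph.subLeft t), ?_⟩
  have : tsupport (fun s => kern n (t - s)) ⊆ (fun s => t - s) ⁻¹' tsupport (kern n) :=
    tsupport_comp_subset_preimage (kern n) (by fun_prop)
  refine this.trans fun s hs => ?_
  rw [mem_preimage, (bump n).tsupport_normed_eq, Metric.mem_closedBall, Real.dist_eq, sub_zero,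
    abs_le] at hs
  constructor <;> linarith [hs.1, hs.2]

end Mollify

/-! ### The energy identity for `f ∈ L²(V)` with `f' ∈ L²(V')` -/

section EnergyIdentity

theorem memLp_indicator_Ioo {V : Type*} [NormedAddCommGroup V] {a b : ℝ} {f : ℝ → V}
    (hf : MemLp f 2 (volume.restrict (Ioo a b))) :
    Integrable ((Ioo a b).indicator f) ∧
      Integrable fun t => ‖(Ioo a b).indicator f t‖ ^ 2 := by
  constructor
  · rw [integrable_indicator_iff measurableSet_Ioo]
    exact hf.integrable (by norm_num)
  · have : MemLp ((Ioo a b).indicator f) 2 volume :=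
      (memLp_indicator_iff_restrict measurableSet_Ioo).2 hf
    exact this.integrable_norm_pow (by norm_num)

variable {V H : Type*} [NormedAddCommGroup V] [NormedSpace ℝ V]
  [NormedAddCommGroup H] [InnerProductSpace ℝ H]

/-- The embedding `V → H ≃ H' → V'` induced by a continuous linear map `V → H`. -/
noncomputable def gramDual (i : V →L[ℝ] H) : V →L[ℝ] StrongDual ℝ V :=
  ((ContinuousLinearMap.compL ℝ V H ℝ).flip i).comp ((innerSL ℝ).comp i)

theorem gramDual_apply_apply (i : V →L[ℝ] H) (v w : V) :
    gramDual i v w = inner ℝ (i v) (i w) := rfl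

/-- `g` is the weak derivative of `f` on `(a, b)`. -/
def HasWeakDerivOn (a b : ℝ) (f g : ℝ → V) : Prop :=
  ∀ φ : ℝ → ℝ, IsTest a b φ →
    ∫ t in Ioo a b, deriv φ t • f t = -∫ t in Ioo a b, φ t • g t

theorem integral_smul_indicator (a b : ℝ) (k : ℝ → ℝ) (f : ℝ → V) :
    ∫ s, k s • (Ioo a b).indicator f s = ∫ s in Ioo a b, k s • f s := by
  rw [← integral_indicator measurableSet_Ioo]
  refine integral_congr_ae (ae_of_all _ fun s => ?_)
  by_cases hs : s ∈ Ioo a b <;> simp [hs]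

theorem abs_apply_le_half_sq (g : StrongDual ℝ V) (v : V) :
    |g v| ≤ 1 / 2 * (‖g‖ ^ 2 + ‖v‖ ^ 2) := by
  have h1 := g.le_opNorm v
  rw [Real.norm_eq_abs] at h1
  nlinarith [sq_nonneg (‖g‖ - ‖v‖)]

theorem integrable_dual_apply {α : Type*} [MeasurableSpace α] {m : Measure α}
    {g : α → StrongDual ℝ V} {f : α → V} (hg : MemLp g 2 m) (hf : MemLp f 2 m) :
    Integrable (fun t => g t (f t)) m := by
  refine Integrable.mono' (((hg.integrable_norm_pow (by norm_num)).add
    (hf.integrable_norm_pow (by norm_num))).const_mul (1 / 2))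
    ((isBoundedBilinearMap_apply (𝕜 := ℝ) (E := V) (F := ℝ)).continuous.comp_aestronglyMeasurable
      (hg.1.prodMk hf.1)) (ae_of_all _ fun t => ?_)
  exact abs_apply_le_half_sq _ _

variable [CompleteSpace V]

/-- The pairing converges almost everywhere and is dominated by the mollification of `(‖g‖² + ‖f‖²)
/ 2`. That majorant changes with `n` but keeps the same integral, so dominated convergence with
varying majorants applies. -/
theorem tendsto_setIntegral_mollify_dual {f : ℝ → V} {g : ℝ → StrongDual ℝ V}
    (hf : Integrable f) (hf2 : Integrable fun t => ‖f t‖ ^ 2)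
    (hg : Integrable g) (hg2 : Integrable fun t => ‖g t‖ ^ 2)
    {A : Set ℝ} (hA : MeasurableSet A) :
    Tendsto (fun n => ∫ t in A, mollify n g t (mollify n f t)) atTop
      (𝓝 (∫ t in A, g t (f t))) := by
  have hc : ∀ n, Continuous fun t => mollify n g t (mollify n f t) := fun n =>
    (continuous_mollify n hg.locallyIntegrable).clm_apply
      (continuous_mollify n hf.locallyIntegrable)
  simp only [← integral_indicator hA]
  refine tendsto_integral_of_dominated_by_convergent
    (h := fun n t => 1 / 2 * (mollify n (fun t => ‖g t‖ ^ 2) t + mollify n (fun t => ‖f t‖ ^ 2) t))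
    (h₀ := fun t => 1 / 2 * (‖g t‖ ^ 2 + ‖f t‖ ^ 2))
    (fun n => (hc n).aestronglyMeasurable.indicator hA)
    (fun n => ((integrable_mollify n hg2).add (integrable_mollify n hf2)).const_mul _)
    ((hg2.add hf2).const_mul _) (fun n => ae_of_all _ fun t => ?_) ?_ ?_ ?_
  · refine (norm_indicator_le_norm_self
      (fun t => mollify n g t (mollify n f t)) t).trans ?_
    rw [Real.norm_eq_abs]
    refine (abs_apply_le_half_sq _ _).trans ?_
    linarith [norm_mollify_sq_le n hf hf2 t, norm_mollify_sq_le n hg hg2 t]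
  · filter_upwards [tendsto_mollify hf.locallyIntegrable,
      tendsto_mollify hg.locallyIntegrable] with t h1 h2
    by_cases ht : t ∈ A
    · simpa [ht, Function.comp_def] using ((isBoundedBilinearMap_apply (𝕜 := ℝ) (E := V)
        (F := ℝ)).continuous.tendsto (g t, f t)).comp (h2.prodMk_nhds h1)
    · simp [ht]
  · filter_upwards [tendsto_mollify hf2.locallyIntegrable,
      tendsto_mollify hg2.locallyIntegrable] with t h1 h2
    exact (h2.add h1).const_mul _
  · refine tendsto_const_nhds.congr fun n => ?_
    rw [integral_const_mul, integral_const_mul, integral_add hg2 hf2,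
      integral_add (integrable_mollify n hg2) (integrable_mollify n hf2),
      integral_mollify n hg2, integral_mollify n hf2]

/-- Differentiation falls on the kernel. When the translated kernel is supported in `(a, b)` it is a
test function, so the weak derivative identity turns `gramDual i` of the derivative into the
mollification of `g`. -/
theorem hasDerivAt_norm_sq_mollify {a b t : ℝ} {n : ℕ} (i : V →L[ℝ] H) {f : ℝ → V}
    {g : ℝ → StrongDual ℝ V} (hf : Integrable ((Ioo a b).indicator f))
    (hw : HasWeakDerivOn a b (fun t => gramDual i (f t)) g)
    (h1 : a + (bump n).rOut < t) (h2 : t + (bump n).rOut < b) :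
    HasDerivAt (fun t => ‖i (mollify n ((Ioo a b).indicator f) t)‖ ^ 2)
      (2 * mollify n ((Ioo a b).indicator g) t (mollify n ((Ioo a b).indicator f) t)) t := by
  set F := (Ioo a b).indicator f
  set F' := ∫ s, deriv (kern n) (t - s) • F s with hF'
  have hd : HasDerivAt (mollify n F) F' t := hasDerivAt_mollify n hf.locallyIntegrable t
  have hJ : gramDual i F' = mollify n ((Ioo a b).indicator g) t := by
    have e := hw _ (isTest_kern h1 h2)
    have hder : ∀ s, deriv (fun s => kern n (t - s)) s = -deriv (kern n) (t - s) := fun s =>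
      deriv_comp_const_sub _ _ _
    rw [mollify_apply, integral_smul_indicator, ← neg_eq_iff_eq_neg.2 e, hF',
      ← ContinuousLinearMap.integral_comp_comm _
        (integrable_deriv_kern_smul n hf.locallyIntegrable t), ← integral_neg]
    simp only [hder, neg_smul, neg_neg, map_smul]
    rw [← integral_smul_indicator a b (fun s => deriv (kern n) (t - s)) fun s => gramDual i (f s)]
    refine integral_congr_ae (ae_of_all _ fun s => ?_)
    by_cases hs : s ∈ Ioo a b <;> simp [F, hs]
  have := (i.hasFDerivAt.comp_hasDerivAt t hd).norm_sq
  rw [← hJ, gramDual_apply_apply, real_inner_comm]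
  exact this

/-- The energy identity for functions `f ∈ L²(a, b; V)` with weak derivative in
`L²(a, b; V')`. -/
theorem norm_sq_sub_norm_sq {a b : ℝ} (i : V →L[ℝ] H) {f : ℝ → V}
    {g : ℝ → StrongDual ℝ V} (hf : MemLp f 2 (volume.restrict (Ioo a b)))
    (hg : MemLp g 2 (volume.restrict (Ioo a b)))
    (hw : HasWeakDerivOn a b (fun t => gramDual i (f t)) g) :
    ∀ᵐ r ∂volume.restrict (Ioo a b), ∀ᵐ s ∂volume.restrict (Ioo a b),
      ‖i (f r)‖ ^ 2 - ‖i (f s)‖ ^ 2 = 2 * ∫ t in s..r, g t (f t) := by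
  obtain ⟨hf1, hf2⟩ := memLp_indicator_Ioo hf
  obtain ⟨hg1, hg2⟩ := memLp_indicator_Ioo hg
  set F := (Ioo a b).indicator f with hF
  set G := (Ioo a b).indicator g with hG
  have hlim : ∀ᵐ t ∂volume.restrict (Ioo a b), t ∈ Ioo a b ∧
      Tendsto (fun n => mollify n F t) atTop (𝓝 (f t)) := by
    filter_upwards [ae_restrict_of_ae (tendsto_mollify hf1.locallyIntegrable),
      ae_restrict_mem measurableSet_Ioo] with t h1 h2
    exact ⟨h2, by simpa [hF, h2] using h1⟩
  filter_upwards [hlim] with r hr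
  filter_upwards [hlim] with s hs
  have hsub : uIcc s r ⊆ Ioo a b := ordConnected_Ioo.uIcc_subset hs.1 hr.1
  have hm : a < min s r := lt_min hs.1.1 hr.1.1
  have hM : max s r < b := max_lt hs.1.2 hr.1.2
  -- Once the bump radius is below the distance from `[s, r]` to the endpoints, the mollified
  -- function is differentiable along the whole segment with the expected derivative, and the
  -- fundamental theorem of calculus applies.
  have hev : ∀ᶠ n in atTop, ‖i (mollify n F r)‖ ^ 2 - ‖i (mollify n F s)‖ ^ 2 =
      2 * ∫ t in s..r, mollify n G t (mollify n F t) := by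
    have e1 := tendsto_bump_rOut.eventually_lt_const (sub_pos.2 hm)
    have e2 := tendsto_bump_rOut.eventually_lt_const (sub_pos.2 hM)
    filter_upwards [e1, e2] with n h1 h2
    rw [← intervalIntegral.integral_const_mul]
    refine (intervalIntegral.integral_eq_sub_of_hasDerivAt
      (f := fun t => ‖i (mollify n F t)‖ ^ 2) (fun t ht => ?_) ?_).symm
    · rw [uIcc, mem_Icc] at ht
      exact hasDerivAt_norm_sq_mollify i hf1 hw (by linarith [ht.1]) (by linarith [ht.2])
    · exact (continuous_const.mul ((continuous_mollify n hg1.locallyIntegrable).clm_apply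
        (continuous_mollify n hf1.locallyIntegrable))).intervalIntegrable _ _
  have hR : Tendsto (fun n => 2 * ∫ t in s..r, mollify n G t (mollify n F t)) atTop
      (𝓝 (2 * ∫ t in s..r, G t (F t))) :=
    ((tendsto_setIntegral_mollify_dual hf1 hf2 hg1 hg2 measurableSet_Ioc).sub
      (tendsto_setIntegral_mollify_dual hf1 hf2 hg1 hg2 measurableSet_Ioc)).const_mul 2
  have hL : Tendsto (fun n => ‖i (mollify n F r)‖ ^ 2 - ‖i (mollify n F s)‖ ^ 2) atTop
      (𝓝 (‖i (f r)‖ ^ 2 - ‖i (f s)‖ ^ 2)) :=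
    (((i.continuous.tendsto _).comp hr.2).norm.pow 2).sub
      (((i.continuous.tendsto _).comp hs.2).norm.pow 2)
  rw [tendsto_nhds_unique (hL.congr' hev) hR]
  congr 1
  refine intervalIntegral.integral_congr fun t ht => ?_
  simp [hF, hG, hsub ht]

/-- The energy identity with vanishing initial value. -/
theorem norm_sq_eq_integral {T : ℝ} (i : V →L[ℝ] H) {f : ℝ → V}
    {g : ℝ → StrongDual ℝ V} (hf : MemLp f 2 (timeMeasure T))
    (hg : MemLp g 2 (timeMeasure T))
    (hw : IsWeakTimeDeriv T (fun t => gramDual i (f t)) g)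
    (h0 : HasInitialValue (fun t => i (f t)) 0) :
    ∀ᵐ r ∂timeMeasure T, ‖i (f r)‖ ^ 2 = 2 * ∫ t in 0..r, g t (f t) := by
  filter_upwards [norm_sq_sub_norm_sq i hf hg hw, ae_restrict_mem measurableSet_Ioo] with r hr hrT
  have hi : IntervalIntegrable (fun t => g t (f t)) volume 0 r := by
    rw [intervalIntegrable_iff_integrableOn_Ioo_of_le hrT.1.le]
    exact (integrable_dual_apply hg hf).mono_measure
      (Measure.restrict_mono (Ioo_subset_Ioo_right hrT.2.le) le_rfl)
  set l : Filter ℝ := 𝓝[>] (0 : ℝ) ⊓ ae volume with hl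
  -- Every `(0, ε)` has positive measure, hence meets every conull set; this makes limits along `l`
  -- unique.
  have hne : l.NeBot := by
    rw [hl, inf_neBot_iff]
    intro s hs s' hs'
    by_contra hem
    rw [not_nonempty_iff_eq_empty] at hem
    obtain ⟨ε, hε, hsub⟩ := mem_nhdsGT_iff_exists_Ioo_subset.1 hs
    have hz : volume (Ioo 0 ε) = 0 := by
      refine measure_mono_null (t := s'ᶜ) (fun x hx hx' => ?_) (mem_ae_iff.1 hs')
      exact (hem ▸ ⟨hsub hx, hx'⟩ : x ∈ (∅ : Set ℝ))
    rw [Real.volume_Ioo, ENNReal.ofReal_eq_zero] at hz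
    linarith [mem_Ioi.1 hε]
  have hev : ∀ᶠ s in l, ‖i (f r)‖ ^ 2 - ‖i (f s)‖ ^ 2 = 2 * ∫ t in s..r, g t (f t) := by
    rw [hl, eventually_inf]
    refine ⟨Ioo 0 T, ?_, {s | s ∈ Ioo 0 T → _}, (ae_restrict_iff' measurableSet_Ioo).1 hr,
      fun s hs => hs.2 hs.1⟩
    exact Ioo_mem_nhdsGT (hrT.1.trans hrT.2)
  have hL : Tendsto (fun s => ‖i (f r)‖ ^ 2 - ‖i (f s)‖ ^ 2) l (𝓝 (‖i (f r)‖ ^ 2)) := by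
    simpa using (tendsto_const_nhds (x := ‖i (f r)‖ ^ 2)).sub (h0.norm.pow 2)
  have hR : Tendsto (fun s => 2 * ∫ t in s..r, g t (f t)) l (𝓝 (2 * ∫ t in 0..r, g t (f t))) := by
    refine Tendsto.const_mul _ ?_
    have hc : ContinuousOn (fun s => ∫ t in s..r, g t (f t)) (uIcc 0 r) := by
      simp_rw [intervalIntegral.integral_symm r]
      exact (intervalIntegral.continuousOn_primitive_interval' hi right_mem_uIcc).neg
    have := hc 0 left_mem_uIcc
    refine this.mono_left (inf_le_left.trans ?_)
    rw [uIcc_of_le hrT.1.le, nhdsWithin_Icc_eq_nhdsGE hrT.1]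
    exact nhdsWithin_mono _ Ioi_subset_Ici_self
  exact tendsto_nhds_unique hL (hR.congr' (hev.mono fun s hs => hs.symm))

end EnergyIdentity

/-! ### Linearity of weak derivatives and initial values -/

theorem IsTest.integrable_smul {V : Type*} [NormedAddCommGroup V] [NormedSpace ℝ V] {a b : ℝ}
    {φ : ℝ → ℝ} (h : IsTest a b φ) {f : ℝ → V} (hf : MemLp f 2 (volume.restrict (Ioo a b))) :
    Integrable (fun t => φ t • f t) (volume.restrict (Ioo a b)) :=
  memLp_one_iff_integrable.1 (hf.smul (r := 1) h.memLp)

theorem IsTest.integrable_deriv_smul {V : Type*} [NormedAddCommGroup V] [NormedSpace ℝ V]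
    {a b : ℝ} {φ : ℝ → ℝ} (h : IsTest a b φ) {f : ℝ → V}
    (hf : MemLp f 2 (volume.restrict (Ioo a b))) :
    Integrable (fun t => deriv φ t • f t) (volume.restrict (Ioo a b)) :=
  memLp_one_iff_integrable.1 (hf.smul (r := 1) h.memLp_deriv)

section WeakDeriv

theorem HasWeakDerivOn.sub {V : Type*} [NormedAddCommGroup V] [NormedSpace ℝ V] {a b : ℝ}
    {f g f' g' : ℝ → V}
    (hf : MemLp f 2 (volume.restrict (Ioo a b))) (hg : MemLp g 2 (volume.restrict (Ioo a b)))
    (hf' : MemLp f' 2 (volume.restrict (Ioo a b))) (hg' : MemLp g' 2 (volume.restrict (Ioo a b)))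
    (h : HasWeakDerivOn a b f g) (h' : HasWeakDerivOn a b f' g') :
    HasWeakDerivOn a b (fun t => f t - f' t) (fun t => g t - g' t) := by
  intro φ hφ
  simp only [smul_sub]
  rw [integral_sub (hφ.integrable_deriv_smul hf) (hφ.integrable_deriv_smul hf'),
    integral_sub (hφ.integrable_smul hg) (hφ.integrable_smul hg'), h φ hφ, h' φ hφ]
  abel

variable {V W : Type*} [NormedAddCommGroup V] [NormedSpace ℝ V] [CompleteSpace V]
  [NormedAddCommGroup W] [NormedSpace ℝ W] [CompleteSpace W] {a b : ℝ}

theorem HasWeakDerivOn.clm_comp (L : V →L[ℝ] W) {f g : ℝ → V}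
    (hf : MemLp f 2 (volume.restrict (Ioo a b))) (hg : MemLp g 2 (volume.restrict (Ioo a b)))
    (h : HasWeakDerivOn a b f g) :
    HasWeakDerivOn a b (fun t => L (f t)) (fun t => L (g t)) := by
  intro φ hφ
  have := congrArg L (h φ hφ)
  rw [map_neg, ← L.integral_comp_comm (hφ.integrable_deriv_smul hf),
    ← L.integral_comp_comm (hφ.integrable_smul hg)] at this
  simpa using this

end WeakDeriv

theorem HasInitialValue.sub {V : Type*} [NormedAddCommGroup V] {f g : ℝ → V} {x : V}
    (hf : HasInitialValue f x) (hg : HasInitialValue g x) :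
    HasInitialValue (fun t => f t - g t) 0 := by
  have := Tendsto.sub hf hg
  rwa [sub_self] at this

/-! ### The Sobolev embedding on an interval -/

theorem L2_inner_eq {a b : ℝ} (f g : L2 a b) :
    inner ℝ f g = ∫ x in Ioo a b, f x * g x := by
  rw [L2.inner_def]
  exact integral_congr_ae (ae_of_all _ fun x => by simp [mul_comm])

theorem L2_norm_sq_eq {a b : ℝ} (f : L2 a b) : ‖f‖ ^ 2 = ∫ x in Ioo a b, f x ^ 2 := by
  rw [← real_inner_self_eq_norm_sq, L2_inner_eq]
  simp only [sq]

/-- The embedding of `H¹(a, b)` into `L^∞(a, b)`. -/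
theorem exists_ae_abs_le {a b : ℝ} (hab : a < b) :
    ∃ C > 0, ∀ f g : L2 a b, IsWeakDeriv f g →
      ∀ᵐ x ∂volume.restrict (Ioo a b), |f x| ≤ C * (‖f‖ + ‖g‖) := by
  have hba : 0 < b - a := sub_pos.2 hab
  -- The constant comes from averaging `f r ^ 2 ≤ f s ^ 2 + ‖f‖ ^ 2 + ‖g‖ ^ 2` over `s` in `(a, b)`.
  refine ⟨√((b - a)⁻¹ + 1), by positivity, fun f g hfg => ?_⟩
  have hf : MemLp f 2 (volume.restrict (Ioo a b)) := Lp.memLp f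
  have hg : MemLp g 2 (volume.restrict (Ioo a b)) := Lp.memLp g
  have hw : HasWeakDerivOn a b f g := by
    intro φ hφ
    simpa [mul_comm] using hfg φ hφ
  -- The energy identity with `V = H = ℝ` reads `f(r)² - f(s)² = 2 ∫ g f`.
  have key := norm_sq_sub_norm_sq (ContinuousLinearMap.id ℝ ℝ) hf
    ((gramDual (ContinuousLinearMap.id ℝ ℝ)).comp_memLp' hg) (hw.clm_comp _ hf hg)
  have hf2 : Integrable (fun x => f x ^ 2) (volume.restrict (Ioo a b)) := hf.integrable_sq
  have hg2 : Integrable (fun x => g x ^ 2) (volume.restrict (Ioo a b)) := hg.integrable_sq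
  filter_upwards [key, ae_restrict_mem measurableSet_Ioo] with r hr hrI
  have hle : ∀ᵐ s ∂volume.restrict (Ioo a b), f r ^ 2 ≤ f s ^ 2 + (‖f‖ ^ 2 + ‖g‖ ^ 2) := by
    filter_upwards [hr, ae_restrict_mem measurableSet_Ioo] with s hs hsI
    have h1 : |∫ t in s..r, gramDual (ContinuousLinearMap.id ℝ ℝ) (g t) (f t)| ≤
        1 / 2 * (‖f‖ ^ 2 + ‖g‖ ^ 2) := by
      rw [← Real.norm_eq_abs, L2_norm_sq_eq f, L2_norm_sq_eq g, ← integral_add hf2 hg2,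
        ← integral_const_mul]
      refine (intervalIntegral.norm_integral_le_integral_norm_uIoc).trans ?_
      have hsub : uIoc s r ⊆ Ioo a b :=
        uIoc_subset_uIcc.trans (ordConnected_Ioo.uIcc_subset hsI hrI)
      have hi : IntegrableOn (fun x => 1 / 2 * (f x ^ 2 + g x ^ 2)) (Ioo a b) :=
        (hf2.add hg2).const_mul _
      have hle : ∀ x, ‖gramDual (ContinuousLinearMap.id ℝ ℝ) (g x) (f x)‖ ≤
          1 / 2 * (f x ^ 2 + g x ^ 2) := by
        intro x
        have : gramDual (ContinuousLinearMap.id ℝ ℝ) (g x) (f x) = f x * g x := by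
          simp [gramDual_apply_apply]
        rw [this, Real.norm_eq_abs, abs_le]
        constructor <;> nlinarith [sq_nonneg (f x - g x), sq_nonneg (f x + g x)]
      refine (integral_mono_of_nonneg (ae_of_all _ fun x => norm_nonneg _)
        (hi.mono_set hsub) (ae_of_all _ hle)).trans ?_
      exact setIntegral_mono_set hi (ae_of_all _ fun x => by positivity) hsub.eventuallyLE
    have h2 := (abs_le.1 h1).2
    simp only [ContinuousLinearMap.id_apply, Real.norm_eq_abs, sq_abs, Function.comp_apply] at hs
    linarith
  have hint := integral_mono_ae (integrable_const _) (hf2.add (integrable_const _)) hle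
  simp only [Pi.add_apply] at hint
  rw [integral_add hf2 (integrable_const _), integral_const, integral_const, ← L2_norm_sq_eq]
    at hint
  simp only [measureReal_restrict_apply_univ, Real.volume_real_Ioo_of_le hab.le, smul_eq_mul]
    at hint
  rw [← Real.sqrt_sq_eq_abs]
  have h3 : f r ^ 2 ≤ ((b - a)⁻¹ + 1) * (‖f‖ + ‖g‖) ^ 2 := by
    have h4 : f r ^ 2 = (b - a)⁻¹ * ((b - a) * f r ^ 2) := by field_simp
    have h5 : (b - a)⁻¹ * (‖f‖ ^ 2 + (b - a) * (‖f‖ ^ 2 + ‖g‖ ^ 2)) =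
        (b - a)⁻¹ * ‖f‖ ^ 2 + (‖f‖ ^ 2 + ‖g‖ ^ 2) := by field_simp
    have h6 : ‖f‖ ^ 2 + ‖g‖ ^ 2 ≤ (‖f‖ + ‖g‖) ^ 2 := by
      nlinarith [mul_nonneg (norm_nonneg f) (norm_nonneg g)]
    have h7 : ‖f‖ ^ 2 ≤ (‖f‖ + ‖g‖) ^ 2 := by linarith [sq_nonneg ‖g‖]
    rw [h4]
    refine (mul_le_mul_of_nonneg_left hint (by positivity)).trans ?_
    rw [h5, add_mul, one_mul]
    gcongr
  calc √(f r ^ 2) ≤ √(((b - a)⁻¹ + 1) * (‖f‖ + ‖g‖) ^ 2) := Real.sqrt_le_sqrt h3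
    _ = _ := by rw [Real.sqrt_mul (by positivity), Real.sqrt_sq (by positivity)]

/-! ### Grönwall's lemma -/

/-- Grönwall's lemma with an integrable coefficient. -/
theorem ae_eq_zero_of_le_integral {T : ℝ} {E q k : ℝ → ℝ}
    (hq : Integrable q (timeMeasure T)) (hk : Integrable k (timeMeasure T))
    (hk0 : ∀ t, 0 ≤ k t) (hE0 : ∀ t, 0 ≤ E t)
    (hE : ∀ᵐ t ∂timeMeasure T, E t = ∫ s in 0..t, q s)
    (hle : ∀ᵐ t ∂timeMeasure T, q t ≤ k t * E t) :
    ∀ᵐ t ∂timeMeasure T, E t = 0 := by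
  rcases le_or_gt T 0 with hT | hT
  · simp [timeMeasure, Ioo_eq_empty_of_le hT]
  set Y : ℝ → ℝ := fun t => ∫ s in 0..t, q s
  have hqi : IntervalIntegrable q volume 0 T :=
    (intervalIntegrable_iff_integrableOn_Ioo_of_le hT.le).2 hq
  have hki : IntervalIntegrable k volume 0 T :=
    (intervalIntegrable_iff_integrableOn_Ioo_of_le hT.le).2 hk
  have hYc : ContinuousOn Y (Icc 0 T) := by
    rw [← uIcc_of_le hT.le]
    exact intervalIntegral.continuousOn_primitive_interval' hqi left_mem_uIcc
  have hle' : ∀ᵐ t ∂timeMeasure T, q t ≤ k t * Y t := by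
    filter_upwards [hE, hle] with t h1 h2
    rwa [h1] at h2
  have hsub : ∀ {x y}, 0 ≤ x → x ≤ y → y ≤ T → uIcc x y ⊆ uIcc 0 T := by
    intro x y h1 h2 h3
    rw [uIcc_of_le h2, uIcc_of_le hT.le]
    exact Icc_subset_Icc h1 h3
  -- Continuation along `[0, T]`, run on the continuous `Y` because `E` agrees with it only almost
  -- everywhere. From `x` with `Y x ≤ 0`, choose `z` with `∫ k < 1/2` on `[x, z]`. A positive
  -- maximum `Y m` on `[x, z]` would satisfy `Y m ≤ Y x + Y m / 2 ≤ Y m / 2`.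
  have hY : Icc 0 T ⊆ {t | Y t ≤ 0} := by
    refine IsClosed.Icc_subset_of_forall_exists_gt ?_ (by simp [Y]) ?_
    · rw [inter_comm]
      exact hYc.preimage_isClosed_of_isClosed isClosed_Icc isClosed_Iic
    · rintro x ⟨hx0, hxT⟩ y hy
      have hkc : ContinuousWithinAt (fun t => ∫ s in x..t, k s) (Icc x T) x := by
        have := (intervalIntegral.continuousOn_primitive_interval'
          (hki.mono_set (hsub hxT.1 hxT.2.le le_rfl)) left_mem_uIcc) x left_mem_uIcc
        rwa [uIcc_of_le hxT.2.le] at this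
      have hsmall : ∀ᶠ t in 𝓝[>] x, ∫ s in x..t, k s < 1 / 2 := by
        have h1 : Tendsto (fun t => ∫ s in x..t, k s) (𝓝[>] x) (𝓝 0) := by
          have := hkc.tendsto
          rw [intervalIntegral.integral_same, nhdsWithin_Icc_eq_nhdsGE hxT.2] at this
          exact this.mono_left (nhdsWithin_mono _ Ioi_subset_Ici_self)
        exact h1.eventually_lt_const (by norm_num)
      obtain ⟨z, hz3, hz1, hz2⟩ := (hsmall.and (Ioc_mem_nhdsGT (lt_min hy hxT.2))).exists
      have hzy : z ≤ y := hz2.trans (min_le_left _ _)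
      have hzT : z ≤ T := hz2.trans (min_le_right _ _)
      refine ⟨z, ?_, hz1, hzy⟩
      obtain ⟨m, hm, hmax⟩ := isCompact_Icc.exists_isMaxOn (nonempty_Icc.2 hz1.le)
        (hYc.mono (Icc_subset_Icc hxT.1 hzT))
      have hmax' : ∀ s ∈ Icc x z, Y s ≤ Y m := fun s hs => hmax hs
      suffices hm0 : Y m ≤ 0 from (hmax' z (right_mem_Icc.2 hz1.le)).trans hm0
      by_contra! hpos
      have hmT : m ≤ T := hm.2.trans hzT
      have i1 : IntervalIntegrable q volume x m := hqi.mono_set (hsub hxT.1 hm.1 hmT)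
      have i2 : IntervalIntegrable k volume x m := hki.mono_set (hsub hxT.1 hm.1 hmT)
      have e1 : Y x + ∫ s in x..m, q s = Y m := intervalIntegral.integral_add_adjacent_intervals
        (hqi.mono_set (hsub le_rfl hxT.1 hxT.2.le)) i1
      have e2 : ∫ s in x..m, q s ≤ ∫ s in x..m, k s * Y m := by
        rw [intervalIntegral.integral_of_le hm.1, intervalIntegral.integral_of_le hm.1,
          integral_Ioc_eq_integral_Ioo, integral_Ioc_eq_integral_Ioo]
        have hss : Ioo x m ⊆ Ioo 0 T := Ioo_subset_Ioo hxT.1 hmT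
        refine setIntegral_mono_ae_restrict (hq.mono_measure (Measure.restrict_mono hss le_rfl))
          ((hk.mono_measure (Measure.restrict_mono hss le_rfl)).mul_const _) ?_
        filter_upwards [ae_restrict_of_ae_restrict_of_subset hss hle',
          ae_restrict_mem measurableSet_Ioo] with s h1 h2
        exact h1.trans (mul_le_mul_of_nonneg_left
          (hmax' s ⟨h2.1.le, h2.2.le.trans hm.2⟩) (hk0 s))
      have e3 : ∫ s in x..m, k s ≤ ∫ s in x..z, k s :=
        intervalIntegral.integral_mono_interval le_rfl hm.1 hm.2 (ae_of_all _ hk0)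
          (hki.mono_set (hsub hxT.1 hz1.le hzT))
      rw [intervalIntegral.integral_mul_const] at e2
      have hx0' : Y x ≤ 0 := hx0
      have : (∫ s in x..m, k s) * Y m ≤ 1 / 2 * Y m := by
        gcongr
        linarith
      linarith
  filter_upwards [hE, ae_restrict_mem measurableSet_Ioo] with t h1 h2
  exact le_antisymm (h1.trans_le (hY ⟨h2.1.le, h2.2.le⟩)) (hE0 t)

/-! ### Uniqueness of weak derivatives, products, and separability -/

theorem IsWeakDeriv.eq_zero {a b : ℝ} {g : L2 a b} (h : IsWeakDeriv 0 g) : g = 0 := by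
  have hg : MemLp g 2 (volume.restrict (Ioo a b)) := Lp.memLp g
  have hloc : LocallyIntegrableOn g (Ioo a b) volume :=
    IntegrableOn.locallyIntegrableOn (hg.integrable (by norm_num))
  have key := isOpen_Ioo.ae_eq_zero_of_integral_contDiff_smul_eq_zero hloc
    fun φ h1 h2 h3 => by
      have e := h φ ⟨h1, h2, h3⟩
      have e0 : ∫ x in Ioo a b, (0 : L2 a b) x * deriv φ x = 0 := by
        rw [integral_congr_ae (g := fun _ => (0 : ℝ)), integral_zero]
        filter_upwards [Lp.coeFn_zero ℝ 2 (volume.restrict (Ioo a b))] with x hx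
        rw [hx, Pi.zero_apply, zero_mul]
      rw [e0, eq_comm, neg_eq_zero] at e
      rw [← setIntegral_eq_integral_of_forall_compl_eq_zero (s := Ioo a b), ← e]
      · simp [mul_comm]
      · intro x hx
        rw [image_eq_zero_of_notMem_tsupport fun hx' => hx (h3 hx'), zero_smul]
  refine Lp.ext ?_
  filter_upwards [(ae_restrict_iff' measurableSet_Ioo).2 key,
    Lp.coeFn_zero ℝ 2 (volume.restrict (Ioo a b))] with x h1 h2
  rw [h1, h2, Pi.zero_apply]

theorem isWeakDeriv_D {a b : ℝ} {k : ℕ} (f : Hk a b k) (i : Fin k) :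
    IsWeakDeriv (D i.castSucc f) (D i.succ f) := f.2 i

theorem isWeakDeriv_D_zero_one {a b : ℝ} (f : Hk a b 2) : IsWeakDeriv (D 0 f) (D 1 f) := f.2 0

/-- The energy controls only the zeroth entry of the tuple; uniqueness of weak derivatives, used
twice, kills the other two. -/
theorem eq_zero_of_D_zero_eq_zero {a b : ℝ} {f : Hk a b 2} (h : D 0 f = 0) : f = 0 := by
  have h1 : D 1 f = 0 := IsWeakDeriv.eq_zero (h ▸ isWeakDeriv_D f 0)
  have h2 : D 2 f = 0 := IsWeakDeriv.eq_zero (h1 ▸ isWeakDeriv_D f 1)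
  refine Subtype.ext (PiLp.ext fun i => ?_)
  fin_cases i
  exacts [h, h1, h2]

/-- The inclusion `H²(a, b) ⊆ H¹(a, b)`. -/
noncomputable def toH1 {a b : ℝ} (f : Hk a b 2) : Hk a b 1 :=
  ⟨WithLp.toLp 2 ![D 0 f, D 1 f], fun i => by
    fin_cases i
    exact isWeakDeriv_D f 0⟩

theorem D_zero_toH1 {a b : ℝ} (f : Hk a b 2) : D 0 (toH1 f) = D 0 f := rfl

theorem D_one_toH1 {a b : ℝ} (f : Hk a b 2) : D 1 (toH1 f) = D 1 f := rfl

theorem H10_inner_eq {a b : ℝ} (f g : H10 a b) :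
    inner ℝ f g = inner ℝ (D0 0 f) (D0 0 g) + inner ℝ (D0 1 f) (D0 1 g) := by
  rw [Submodule.coe_inner, Submodule.coe_inner, PiLp.inner_apply, Fin.sum_univ_two]
  rfl

theorem norm_D0_zero_le {a b : ℝ} (f : H10 a b) : ‖D0 0 f‖ ≤ ‖f‖ := by
  have h := H10_inner_eq f f
  simp only [real_inner_self_eq_norm_sq] at h
  have h' : ‖D0 0 f‖ ^ 2 ≤ ‖f‖ ^ 2 := (le_add_of_nonneg_right (sq_nonneg _)).trans_eq h.symm
  exact (abs_le_of_sq_le_sq' h' (norm_nonneg _)).2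

/-- Lets the trilinear term `∫ θ u_tx ψ` be treated as an `L²` inner product with `ψ`. -/
theorem exists_mul_mem_L2 {a b M : ℝ} {f : L2 a b}
    (hf : ∀ᵐ x ∂volume.restrict (Ioo a b), |f x| ≤ M) (g : L2 a b) :
    ∃ F : L2 a b, (F =ᵐ[volume.restrict (Ioo a b)] fun x => f x * g x) ∧ ‖F‖ ≤ M * ‖g‖ := by
  have hle : ∀ᵐ x ∂volume.restrict (Ioo a b), ‖f x * g x‖ ≤ M * ‖g x‖ := by
    filter_upwards [hf] with x hx
    rw [norm_mul]
    exact mul_le_mul_of_nonneg_right hx (norm_nonneg _)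
  have hm : MemLp (fun x => f x * g x) 2 (volume.restrict (Ioo a b)) :=
    (Lp.memLp g).of_le_mul ((Lp.aestronglyMeasurable f).mul (Lp.aestronglyMeasurable g)) hle
  refine ⟨hm.toLp _, hm.coeFn_toLp, Lp.norm_le_mul_norm_of_ae_le_mul ?_⟩
  filter_upwards [hle, hm.coeFn_toLp] with x h1 h2
  rwa [h2]

theorem L2_inner_of_ae_eq {a b : ℝ} {F : L2 a b} {p : ℝ → ℝ}
    (hF : F =ᵐ[volume.restrict (Ioo a b)] p) (h : L2 a b) :
    ∫ x in Ioo a b, p x * h x = inner ℝ F h := by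
  rw [L2_inner_eq]
  refine integral_congr_ae ?_
  filter_upwards [hF] with x hx
  rw [hx]

/-- Discard the countably many null sets attached to a dense sequence, then extend by continuity.
This permits test functions that depend on `t`. -/
theorem ae_forall_eq_zero_of_forall_ae {α X : Type*} [MeasurableSpace α] {m : Measure α}
    [TopologicalSpace X] [TopologicalSpace.SeparableSpace X] {F : α → X → ℝ}
    (hc : ∀ᵐ t ∂m, Continuous (F t)) (h : ∀ x, ∀ᵐ t ∂m, F t x = 0) :
    ∀ᵐ t ∂m, ∀ x, F t x = 0 := by
  obtain ⟨s, hs, hd⟩ := TopologicalSpace.exists_countable_dense X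
  filter_upwards [hc, (ae_ball_iff hs).2 fun x _ => h x] with t h1 h2 x
  exact congrFun (h1.ext_on hd continuous_const fun x hx => h2 x hx) x

instance instSecondCountableHk (a b : ℝ) (k : ℕ) : SecondCountableTopology (Hk a b k) := by
  have : Fact ((2 : ℝ≥0∞) ≠ ⊤) := ⟨by norm_num⟩
  have : SecondCountableTopology (L2 a b) := Lp.SecondCountableTopology
  have : SecondCountableTopology (PiLp 2 fun _ : Fin (k + 1) => L2 a b) :=
    (PiLp.homeomorph 2 fun _ : Fin (k + 1) => L2 a b).secondCountableTopology
  exact inferInstanceAs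
    (SecondCountableTopology (Hk a b k : Set (PiLp 2 fun _ : Fin (k + 1) => L2 a b)))

/-! ### The energy inequality at a fixed time -/

/-- Here `A = ‖w_t‖`, `B = ‖w‖_{H¹}`, `Z = ‖z‖`, `X = ‖z_x‖`, `W = ‖w_tx‖`, `p = ‖u_tx‖`, `m = ‖η‖ +
‖η_x‖`. Young's inequality spends all of `ν W²` on the `η w_tx` term, and half of `X²` on each of
the coupling `z_x w_t` and the term `z u_tx`. -/
theorem energy_arith {μ ν C A B Z X W p m w₁ i₁ i₂ i₃ i₄ i₅ i₆ : ℝ} (hμ : 0 < μ) (hν : 0 < ν)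
    (hwave : w₁ + i₁ + ν * W ^ 2 + μ * i₂ = 0) (hheat : i₃ + X ^ 2 + μ * (i₄ + i₅) = 0)
    (b1 : i₆ ≤ B * A) (b2 : -(X * A) ≤ i₂) (b3 : -(C * (Z + X) * p * Z) ≤ i₄)
    (b4 : -(C * m * W * Z) ≤ i₅) :
    w₁ + (i₆ + i₁) + i₃ ≤ (1 + μ ^ 2 + μ ^ 2 * C ^ 2 * p ^ 2 + μ ^ 2 * C ^ 2 * m ^ 2 / (4 * ν)) *
      (A ^ 2 + B ^ 2 + Z ^ 2) := by
  have b2' := mul_le_mul_of_nonneg_left b2 hμ.le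
  have b3' := mul_le_mul_of_nonneg_left b3 hμ.le
  have b4' := mul_le_mul_of_nonneg_left b4 hμ.le
  have y1 : μ * C * m * W * Z ≤ ν * W ^ 2 + μ ^ 2 * C ^ 2 * m ^ 2 / (4 * ν) * Z ^ 2 := by
    have : ν * W ^ 2 + μ ^ 2 * C ^ 2 * m ^ 2 / (4 * ν) * Z ^ 2 - μ * C * m * W * Z
        = (2 * ν * W - μ * C * m * Z) ^ 2 / (4 * ν) := by
      field_simp
      ring
    have : 0 ≤ (2 * ν * W - μ * C * m * Z) ^ 2 / (4 * ν) := by positivity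
    linarith
  have y2 : B * A ≤ A ^ 2 / 2 + B ^ 2 / 2 := by linarith [sq_nonneg (A - B)]
  have y3 : μ * X * A ≤ X ^ 2 / 2 + μ ^ 2 * A ^ 2 / 2 := by linarith [sq_nonneg (X - μ * A)]
  have y4 : μ * C * X * p * Z ≤ X ^ 2 / 2 + μ ^ 2 * C ^ 2 * p ^ 2 * Z ^ 2 / 2 := by
    linarith [sq_nonneg (X - μ * C * p * Z)]
  have y5 : μ * C * p * Z ^ 2 ≤ Z ^ 2 / 2 + μ ^ 2 * C ^ 2 * p ^ 2 * Z ^ 2 / 2 := by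
    linarith [sq_nonneg (Z - μ * C * p * Z)]
  have n1 : 0 ≤ μ ^ 2 * C ^ 2 * p ^ 2 * (A ^ 2 + B ^ 2) := by positivity
  have n2 : 0 ≤ μ ^ 2 * C ^ 2 * m ^ 2 / (4 * ν) * (A ^ 2 + B ^ 2) := by positivity
  have n3 : 0 ≤ μ ^ 2 * (A ^ 2 / 2 + B ^ 2 + Z ^ 2) := by positivity
  have n4 : 0 ≤ A ^ 2 / 2 + B ^ 2 / 2 + Z ^ 2 / 2 := by positivity
  linarith

/-- The instantaneous energy inequality for the difference of two solutions. -/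
theorem energy_inequality {a b μ ν C : ℝ} (hμ : 0 < μ) (hν : 0 < ν)
    (hsob : ∀ f g : L2 a b, IsWeakDeriv f g →
      ∀ᵐ x ∂volume.restrict (Ioo a b), |f x| ≤ C * (‖f‖ + ‖g‖))
    {u v ut vt : H10 a b} {utt vtt : Hneg a b} {θ η : Hk a b 2} {θt ηt : L2 a b}
    (hu : ∀ φ : H10 a b, utt φ + (∫ x in Ioo a b, D0 1 u x * D0 1 φ x)
      + ν * (∫ x in Ioo a b, D0 1 ut x * D0 1 φ x) + μ * (∫ x in Ioo a b, D 1 θ x * D0 0 φ x) = 0)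
    (hv : ∀ φ : H10 a b, vtt φ + (∫ x in Ioo a b, D0 1 v x * D0 1 φ x)
      + ν * (∫ x in Ioo a b, D0 1 vt x * D0 1 φ x) + μ * (∫ x in Ioo a b, D 1 η x * D0 0 φ x) = 0)
    (hθ : ∀ ψ : Hk a b 1, (∫ x in Ioo a b, θt x * D 0 ψ x) + (∫ x in Ioo a b, D 1 θ x * D 1 ψ x)
      + μ * (∫ x in Ioo a b, D 0 θ x * D0 1 ut x * D 0 ψ x) = 0)
    (hη : ∀ ψ : Hk a b 1, (∫ x in Ioo a b, ηt x * D 0 ψ x) + (∫ x in Ioo a b, D 1 η x * D 1 ψ x)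
      + μ * (∫ x in Ioo a b, D 0 η x * D0 1 vt x * D 0 ψ x) = 0) :
    (utt - vtt) (ut - vt) + inner ℝ (u - v) (ut - vt) + inner ℝ (θt - ηt) (D 0 (θ - η)) ≤
      (1 + μ ^ 2 + μ ^ 2 * C ^ 2 * ‖D0 1 ut‖ ^ 2
        + μ ^ 2 * C ^ 2 * (‖D 0 η‖ + ‖D 1 η‖) ^ 2 / (4 * ν)) *
      (‖D0 0 (ut - vt)‖ ^ 2 + ‖u - v‖ ^ 2 + ‖D 0 (θ - η)‖ ^ 2) := by
  set w := u - v with hw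
  set wt := ut - vt with hwt
  set z := θ - η with hz
  obtain ⟨P, hP, -⟩ := exists_mul_mem_L2 (hsob _ _ (isWeakDeriv_D_zero_one θ)) (D0 1 ut)
  obtain ⟨Q, hQ, -⟩ := exists_mul_mem_L2 (hsob _ _ (isWeakDeriv_D_zero_one η)) (D0 1 vt)
  obtain ⟨F, hF, hFn⟩ := exists_mul_mem_L2 (hsob _ _ (isWeakDeriv_D_zero_one z)) (D0 1 ut)
  obtain ⟨G, hG, hGn⟩ := exists_mul_mem_L2 (hsob _ _ (isWeakDeriv_D_zero_one η)) (D0 1 wt)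
  -- The splitting `θ u_tx - η v_tx = z u_tx + η w_tx`.
  have hPQ : P - Q = F + G := by
    refine Lp.ext ?_
    have e1 : D 0 z = D 0 θ - D 0 η := map_sub _ _ _
    have e2 : D0 1 wt = D0 1 ut - D0 1 vt := map_sub _ _ _
    have c1 := Lp.coeFn_sub (D 0 θ) (D 0 η)
    have c2 := Lp.coeFn_sub (D0 1 ut) (D0 1 vt)
    rw [← e1] at c1
    rw [← e2] at c2
    filter_upwards [hP, hQ, hF, hG, c1, c2, Lp.coeFn_sub P Q, Lp.coeFn_add F G]
      with x x1 x2 x3 x4 x5 x6 x7 x8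
    rw [x7, x8, Pi.sub_apply, Pi.add_apply, x1, x2, x3, x4, x5, x6, Pi.sub_apply, Pi.sub_apply]
    ring
  have hu' := hu wt
  have hv' := hv wt
  have hθ' := hθ (toH1 z)
  have hη' := hη (toH1 z)
  simp only [← L2_inner_eq] at hu' hv'
  rw [D_zero_toH1, D_one_toH1, L2_inner_of_ae_eq hP, ← L2_inner_eq, ← L2_inner_eq] at hθ'
  rw [D_zero_toH1, D_one_toH1, L2_inner_of_ae_eq hQ, ← L2_inner_eq, ← L2_inner_eq] at hη'
  have w1 : D0 1 w = D0 1 u - D0 1 v := map_sub _ _ _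
  have wt1 : D0 1 wt = D0 1 ut - D0 1 vt := map_sub _ _ _
  have z1 : D 1 z = D 1 θ - D 1 η := map_sub _ _ _
  have hwave : (utt - vtt) wt + inner ℝ (D0 1 w) (D0 1 wt) + ν * ‖D0 1 wt‖ ^ 2
      + μ * inner ℝ (D 1 z) (D0 0 wt) = 0 := by
    have e : inner ℝ (D0 1 wt) (D0 1 wt) = ‖D0 1 wt‖ ^ 2 := real_inner_self_eq_norm_sq _
    rw [← e, w1, z1]
    nth_rewrite 2 [wt1]
    rw [inner_sub_left, inner_sub_left, inner_sub_left, _root_.sub_apply]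
    linarith
  have hheat : inner ℝ (θt - ηt) (D 0 z) + ‖D 1 z‖ ^ 2
      + μ * (inner ℝ F (D 0 z) + inner ℝ G (D 0 z)) = 0 := by
    have e : inner ℝ (D 1 z) (D 1 z) = ‖D 1 z‖ ^ 2 := real_inner_self_eq_norm_sq _
    rw [← inner_add_left, ← hPQ, ← e]
    nth_rewrite 1 [z1]
    rw [inner_sub_left, inner_sub_left, inner_sub_left]
    linarith
  -- The `w_x` part of the `H¹` product is supplied by the wave equation; the zeroth-order part is
  -- extra and is bounded by `b1`.
  rw [H10_inner_eq w wt]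
  have b1 : inner ℝ (D0 0 w) (D0 0 wt) ≤ ‖w‖ * ‖D0 0 wt‖ :=
    (real_inner_le_norm _ _).trans (mul_le_mul_of_nonneg_right (norm_D0_zero_le w) (norm_nonneg _))
  have b2 := (abs_le.1 (abs_real_inner_le_norm (D 1 z) (D0 0 wt))).1
  have b3 : -(C * (‖D 0 z‖ + ‖D 1 z‖) * ‖D0 1 ut‖ * ‖D 0 z‖) ≤ inner ℝ F (D 0 z) := by
    refine le_trans ?_ (abs_le.1 (abs_real_inner_le_norm F (D 0 z))).1
    exact neg_le_neg (mul_le_mul_of_nonneg_right hFn (norm_nonneg _))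
  have b4 : -(C * (‖D 0 η‖ + ‖D 1 η‖) * ‖D0 1 wt‖ * ‖D 0 z‖) ≤ inner ℝ G (D 0 z) := by
    refine le_trans ?_ (abs_le.1 (abs_real_inner_le_norm G (D 0 z))).1
    exact neg_le_neg (mul_le_mul_of_nonneg_right hGn (norm_nonneg _))
  exact energy_arith hμ hν hwave hheat b1 b2 b3 b4

/-! ### Energy identities for differences -/

section Difference

variable {V H : Type*} [NormedAddCommGroup V] [NormedSpace ℝ V] [CompleteSpace V]
  [NormedAddCommGroup H] [InnerProductSpace ℝ H]

/-- The energy identity for the difference of two functions with the same initial value. -/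
theorem norm_sq_sub_eq_integral {T : ℝ} (i : V →L[ℝ] H) {f f' : ℝ → V}
    {g g' : ℝ → StrongDual ℝ V} {x : H} (hf : MemLp f 2 (timeMeasure T))
    (hg : MemLp g 2 (timeMeasure T)) (hf' : MemLp f' 2 (timeMeasure T))
    (hg' : MemLp g' 2 (timeMeasure T)) (hw : IsWeakTimeDeriv T (fun t => gramDual i (f t)) g)
    (hw' : IsWeakTimeDeriv T (fun t => gramDual i (f' t)) g')
    (h0 : HasInitialValue (fun t => i (f t)) x) (h0' : HasInitialValue (fun t => i (f' t)) x) :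
    Integrable (fun t => (g t - g' t) (f t - f' t)) (timeMeasure T) ∧
      ∀ᵐ r ∂timeMeasure T,
        ‖i (f r - f' r)‖ ^ 2 = 2 * ∫ t in 0..r, (g t - g' t) (f t - f' t) := by
  refine ⟨integrable_dual_apply (hg.sub hg') (hf.sub hf'),
    norm_sq_eq_integral (f := fun t => f t - f' t) (g := fun t => g t - g' t) i (hf.sub hf')
      (hg.sub hg') ?_ ?_⟩
  · simp only [map_sub]
    exact HasWeakDerivOn.sub ((gramDual i).comp_memLp' hf) hg ((gramDual i).comp_memLp' hf') hg'
      hw hw'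
  · simp only [map_sub]
    exact h0.sub h0'

/-- The energy identity for the difference of two functions `f`, `f'` with the same initial
value, such that `i ∘ f` and `i ∘ f'` are weakly differentiable in `H`. -/
theorem norm_sq_sub_eq_integral_inner [CompleteSpace H] {T : ℝ} (i : V →L[ℝ] H) {f f' : ℝ → V}
    {g g' : ℝ → H} {x : H} (hf : MemLp f 2 (timeMeasure T))
    (hg : MemLp g 2 (timeMeasure T)) (hf' : MemLp f' 2 (timeMeasure T))
    (hg' : MemLp g' 2 (timeMeasure T)) (hw : IsWeakTimeDeriv T (fun t => i (f t)) g)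
    (hw' : IsWeakTimeDeriv T (fun t => i (f' t)) g')
    (h0 : HasInitialValue (fun t => i (f t)) x) (h0' : HasInitialValue (fun t => i (f' t)) x) :
    Integrable (fun t => inner ℝ (g t - g' t) (i (f t - f' t))) (timeMeasure T) ∧
      ∀ᵐ r ∂timeMeasure T,
        ‖i (f r - f' r)‖ ^ 2 = 2 * ∫ t in 0..r, inner ℝ (g t - g' t) (i (f t - f' t)) := by
  -- The embedding `h ↦ ⟨h, i ·⟩` turns an `H`-valued derivative into a `V'`-valued one.
  let L : H →L[ℝ] StrongDual ℝ V :=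
    ((ContinuousLinearMap.compL ℝ V H ℝ).flip i).comp (innerSL ℝ)
  have key := norm_sq_sub_eq_integral i hf (L.comp_memLp' hg) hf' (L.comp_memLp' hg')
    (HasWeakDerivOn.clm_comp L (i.comp_memLp' hf) hg hw)
    (HasWeakDerivOn.clm_comp L (i.comp_memLp' hf') hg' hw') h0 h0'
  simp only [Function.comp_apply, ← map_sub] at key
  exact key

end Difference

/-- The energy identity for the difference of two weakly differentiable functions with the same
initial value. -/
theorem norm_sq_sub_eq_integral_inner_self {X : Type*} [NormedAddCommGroup X]
    [InnerProductSpace ℝ X] [CompleteSpace X] {T : ℝ} {f f' g g' : ℝ → X} {x : X}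
    (hf : MemLp f 2 (timeMeasure T))
    (hg : MemLp g 2 (timeMeasure T)) (hf' : MemLp f' 2 (timeMeasure T))
    (hg' : MemLp g' 2 (timeMeasure T)) (hw : IsWeakTimeDeriv T f g)
    (hw' : IsWeakTimeDeriv T f' g') (h0 : HasInitialValue f x) (h0' : HasInitialValue f' x) :
    Integrable (fun t => inner ℝ (f t - f' t) (g t - g' t)) (timeMeasure T) ∧
      ∀ᵐ r ∂timeMeasure T,
        ‖f r - f' r‖ ^ 2 = 2 * ∫ t in 0..r, inner ℝ (f t - f' t) (g t - g' t) := by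
  have key := norm_sq_sub_eq_integral_inner (ContinuousLinearMap.id ℝ X) hf hg hf' hg' hw hw'
    h0 h0'
  simp only [ContinuousLinearMap.id_apply] at key
  simp only [real_inner_comm (g _ - g' _)]
  exact key

theorem integrable_norm_clm_sq {V W : Type*} [NormedAddCommGroup V] [NormedSpace ℝ V]
    [NormedAddCommGroup W] [NormedSpace ℝ W] (L : V →L[ℝ] W) {T : ℝ} {f : ℝ → V}
    (hf : MemLp f 2 (timeMeasure T)) : Integrable (fun t => ‖L (f t)‖ ^ 2) (timeMeasure T) :=
  (L.comp_memLp' hf).integrable_norm_pow (by norm_num)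

/-! ### Uniqueness of weak solutions -/

namespace IsWeakSolutionWith

variable {a b μ ν T : ℝ} {u₀ : H10 a b} {u₁ : L2 a b} {θ₀ : Hk a b 1}
  {u ut : ℝ → H10 a b} {utt : ℝ → Hneg a b} {θ : ℝ → Hk a b 2} {θt : ℝ → L2 a b}
  {v vt : ℝ → H10 a b} {vtt : ℝ → Hneg a b} {η : ℝ → Hk a b 2} {ηt : ℝ → L2 a b}

theorem ae_wave (h : IsWeakSolutionWith a b μ ν T u₀ u₁ θ₀ u ut utt θ θt) :
    ∀ᵐ t ∂timeMeasure T, ∀ φ : H10 a b,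
      utt t φ + (∫ x in Ioo a b, D0 1 (u t) x * D0 1 φ x)
        + ν * (∫ x in Ioo a b, D0 1 (ut t) x * D0 1 φ x)
        + μ * (∫ x in Ioo a b, D 1 (θ t) x * D0 0 φ x) = 0 := by
  have : SecondCountableTopology (H10 a b) :=
    inferInstanceAs (SecondCountableTopology (H10 a b : Set (Hk a b 1)))
  refine ae_forall_eq_zero_of_forall_ae (ae_of_all _ fun t => ?_) h.wave
  simp only [← L2_inner_eq]
  fun_prop

theorem ae_heat (hab : a < b) (h : IsWeakSolutionWith a b μ ν T u₀ u₁ θ₀ u ut utt θ θt) :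
    ∀ᵐ t ∂timeMeasure T, ∀ ψ : Hk a b 1,
      (∫ x in Ioo a b, θt t x * D 0 ψ x) + (∫ x in Ioo a b, D 1 (θ t) x * D 1 ψ x)
        + μ * (∫ x in Ioo a b, D 0 (θ t) x * D0 1 (ut t) x * D 0 ψ x) = 0 := by
  obtain ⟨C, -, hC⟩ := exists_ae_abs_le hab
  refine ae_forall_eq_zero_of_forall_ae (ae_of_all _ fun t => ?_) h.heat
  -- Continuity in `ψ` requires `θ u_tx ∈ L²`, which the Sobolev bound on `θ` provides.
  obtain ⟨P, hP, -⟩ := exists_mul_mem_L2 (hC _ _ (isWeakDeriv_D_zero_one (θ t))) (D0 1 (ut t))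
  simp only [L2_inner_of_ae_eq hP, ← L2_inner_eq]
  fun_prop

/-- The map `toHneg (D0 0 ·)` is by definition `gramDual (D0 0)`, so `deriv_ut` is already in the
form the energy identity takes. -/
theorem energy_ut (h : IsWeakSolutionWith a b μ ν T u₀ u₁ θ₀ u ut utt θ θt)
    (h' : IsWeakSolutionWith a b μ ν T u₀ u₁ θ₀ v vt vtt η ηt) :
    Integrable (fun t => (utt t - vtt t) (ut t - vt t)) (timeMeasure T) ∧
      ∀ᵐ r ∂timeMeasure T,
        ‖D0 0 (ut r - vt r)‖ ^ 2 = 2 * ∫ t in 0..r, (utt t - vtt t) (ut t - vt t) :=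
  @norm_sq_sub_eq_integral (H10 a b) (L2 a b) inferInstance inferInstance inferInstance inferInstance
    inferInstance T (D0 0) ut vt utt vtt u₁ h.ut_mem h.utt_mem h'.ut_mem h'.utt_mem h.deriv_ut h'.deriv_ut
    h.init_ut h'.init_ut

theorem energy_u (h : IsWeakSolutionWith a b μ ν T u₀ u₁ θ₀ u ut utt θ θt)
    (h' : IsWeakSolutionWith a b μ ν T u₀ u₁ θ₀ v vt vtt η ηt) :
    Integrable (fun t => inner ℝ (u t - v t) (ut t - vt t)) (timeMeasure T) ∧
      ∀ᵐ r ∂timeMeasure T,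
        ‖u r - v r‖ ^ 2 = 2 * ∫ t in 0..r, inner ℝ (u t - v t) (ut t - vt t) :=
  @norm_sq_sub_eq_integral_inner_self (H10 a b) inferInstance inferInstance inferInstance T u v ut vt
    u₀ h.u_mem h.ut_mem h'.u_mem h'.ut_mem h.deriv_u h'.deriv_u
    h.init_u h'.init_u

theorem energy_θ (h : IsWeakSolutionWith a b μ ν T u₀ u₁ θ₀ u ut utt θ θt)
    (h' : IsWeakSolutionWith a b μ ν T u₀ u₁ θ₀ v vt vtt η ηt) :
    Integrable (fun t => inner ℝ (θt t - ηt t) (D 0 (θ t - η t))) (timeMeasure T) ∧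
      ∀ᵐ r ∂timeMeasure T,
        ‖D 0 (θ r - η r)‖ ^ 2 = 2 * ∫ t in 0..r, inner ℝ (θt t - ηt t) (D 0 (θ t - η t)) :=
  norm_sq_sub_eq_integral_inner (D 0) h.θ_mem h.θt_mem h'.θ_mem h'.θt_mem h.deriv_θ h'.deriv_θ
    h.init_θ h'.init_θ

/-- This is the Grönwall coefficient; the leading 2 is the one in `E' = 2 (…)`. Square integrability
of `ut` in `H¹_0` and of `η` in `H²` suffices. -/
theorem integrable_coefficient (h : IsWeakSolutionWith a b μ ν T u₀ u₁ θ₀ u ut utt θ θt)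
    (h' : IsWeakSolutionWith a b μ ν T u₀ u₁ θ₀ v vt vtt η ηt) (C : ℝ) :
    Integrable (fun t => 2 * (1 + μ ^ 2 + μ ^ 2 * C ^ 2 * ‖D0 1 (ut t)‖ ^ 2
      + μ ^ 2 * C ^ 2 * (‖D 0 (η t)‖ + ‖D 1 (η t)‖) ^ 2 / (4 * ν))) (timeMeasure T) := by
  have m0 : MemLp (fun t => D 0 (η t)) 2 (timeMeasure T) := (D 0).comp_memLp' h'.θ_mem
  have m1 : MemLp (fun t => D 1 (η t)) 2 (timeMeasure T) := (D 1).comp_memLp' h'.θ_mem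
  have k1 : Integrable (fun t => ‖D0 1 (ut t)‖ ^ 2) (timeMeasure T) :=
    @integrable_norm_clm_sq (H10 a b) (L2 a b) inferInstance inferInstance inferInstance inferInstance
      (D0 1) T ut h.ut_mem
  have k2 : Integrable (fun t => (‖D 0 (η t)‖ + ‖D 1 (η t)‖) ^ 2) (timeMeasure T) :=
    (m0.norm.add m1.norm).integrable_sq
  exact (((integrable_const _).add (k1.const_mul _)).add
    ((k2.const_mul _).div_const _)).const_mul 2

theorem ae_eq (hab : a < b) (hμ : 0 < μ) (hν : 0 < ν)
    (h : IsWeakSolutionWith a b μ ν T u₀ u₁ θ₀ u ut utt θ θt)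
    (h' : IsWeakSolutionWith a b μ ν T u₀ u₁ θ₀ v vt vtt η ηt) :
    ∀ᵐ t ∂timeMeasure T, u t = v t ∧ θ t = η t := by
  obtain ⟨C, -, hC⟩ := exists_ae_abs_le hab
  obtain ⟨q1, e1⟩ := h.energy_ut h'
  obtain ⟨q2, e2⟩ := h.energy_u h'
  obtain ⟨q3, e3⟩ := h.energy_θ h'
  have hE := ae_eq_zero_of_le_integral (T := T)
    (E := fun t => ‖D0 0 (ut t - vt t)‖ ^ 2 + ‖u t - v t‖ ^ 2 + ‖D 0 (θ t - η t)‖ ^ 2)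
    (q := fun t => 2 * ((utt t - vtt t) (ut t - vt t) + inner ℝ (u t - v t) (ut t - vt t)
      + inner ℝ (θt t - ηt t) (D 0 (θ t - η t))))
    (((q1.add q2).add q3).const_mul 2) (h.integrable_coefficient h' C)
    (fun t => by positivity) (fun t => by positivity) ?_ ?_
  · filter_upwards [hE] with t ht
    have p1 := sq_nonneg ‖D0 0 (ut t - vt t)‖
    have p2 := sq_nonneg ‖u t - v t‖
    have p3 := sq_nonneg ‖D 0 (θ t - η t)‖
    have n2 : ‖u t - v t‖ ^ 2 = 0 := by linarith
    have n3 : ‖D 0 (θ t - η t)‖ ^ 2 = 0 := by linarith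
    have n2' : u t - v t = 0 := norm_eq_zero.1 (sq_eq_zero_iff.1 n2)
    have n3' : D 0 (θ t - η t) = 0 := norm_eq_zero.1 (sq_eq_zero_iff.1 n3)
    exact ⟨sub_eq_zero.1 n2', sub_eq_zero.1 (eq_zero_of_D_zero_eq_zero n3')⟩
  -- The three energy identities add up to `E = ∫ q`.
  · filter_upwards [e1, e2, e3, ae_restrict_mem measurableSet_Ioo] with t h1 h2 h3 ht
    have ii : ∀ {q : ℝ → ℝ}, Integrable q (timeMeasure T) → IntervalIntegrable q volume 0 t := by
      intro q hq
      rw [intervalIntegrable_iff_integrableOn_Ioo_of_le ht.1.le]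
      exact hq.mono_measure (Measure.restrict_mono (Ioo_subset_Ioo_right ht.2.le) le_rfl)
    have q12 : Integrable (fun t => (utt t - vtt t) (ut t - vt t)
        + inner ℝ (u t - v t) (ut t - vt t)) (timeMeasure T) := q1.add q2
    rw [intervalIntegral.integral_const_mul, intervalIntegral.integral_add (ii q12) (ii q3),
      intervalIntegral.integral_add (ii q1) (ii q2), mul_add, mul_add, h1, h2, h3]
  · filter_upwards [h.ae_wave, h'.ae_wave, h.ae_heat hab, h'.ae_heat hab] with t h1 h2 h3 h4
    rw [mul_assoc]
    exact mul_le_mul_of_nonneg_left (energy_inequality hμ hν hC h1 h2 h3 h4) zero_le_two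

end IsWeakSolutionWith

end Thermo

theorem mainTheorem4 (a b μ ν T : ℝ) (hab : a < b) (hμ : 0 < μ) (hν : 0 < ν) (hT : 0 < T)
    (u₀ : Thermo.H10 a b) (u₁ : Thermo.L2 a b) (θ₀ : Thermo.Hk a b 1)
    (hθ₀ : 0 ≤ Thermo.D 0 θ₀)
    (u v : ℝ → Thermo.H10 a b) (θ η : ℝ → Thermo.Hk a b 2)
    (huθ : Thermo.IsWeakSolution a b μ ν T u₀ u₁ θ₀ u θ)
    (hvη : Thermo.IsWeakSolution a b μ ν T u₀ u₁ θ₀ v η) :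
    (∀ᵐ t ∂Thermo.timeMeasure T, u t = v t) ∧ (∀ᵐ t ∂Thermo.timeMeasure T, θ t = η t) := by
  obtain ⟨ut, utt, θt, h⟩ := huθ
  obtain ⟨vt, vtt, ηt, h'⟩ := hvη
  exact eventually_and.1 (h.ae_eq hab hμ hν h')
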